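/- Let $\Lambda$ be an artin algebra (a ring that is a finitely generated module over some commutative artinian ring $R$ for which it is an $R$-algebra). Let $\operatorname{mod}\Lambda$ be the category of finitely presented right $\Lambda$-modules, $\operatorname{prj}\Lambda$ its full subcategory of projective modules, and let $\mathcal X$ be a contravariantly finite full subcategory of $\operatorname{mod}\Lambda$ containing $\operatorname{prj}\Lambda$; that is, every $M\in\operatorname{mod}\Lambda$ admits a morphism $X_0\to M$ with $X_0\in\mathcal X$ through which every morphism from an object of $\mathcal X$ to $M$ factors. Let $\operatorname{mod}\mathcal X$ be the abelian category of finitely presented contravariant additive functors $F:\mathcal X\to\mathcal Ab$, i.e. those with an exact sequence $\mathcal X(-,X_1)\xrightarrow{(-,d)}\mathcal X(-,X_0)\to F\to 0$, $X_0,X_1\in\mathcal X$. Let $e:\operatorname{mod}\mathcal X\to\operatorname{mod}\Lambda$ be the exact functor with $e(F)=\operatorname{Coker}(d:X_1\to X_0)$, defined on morphisms by lifting them to the presentations. For an abelian category $\mathcal A$ let $\mathbb K^{b}(\mathcal A)$ be the homotopy category of bounded complexes over $\mathcal A$, $\mathbb K^{b}_{\rm ac}(\mathcal A)$ its full subcategory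 of acyclic complexes, and $\mathbb D^{b}(\mathcal A)=\mathbb K^{b}(\mathcal A)/\mathbb K^{b}_{\rm ac}(\mathcal A)$ (Verdier quotient). Let $\mathbb D^{b}_{e}:\mathbb D^{b}(\operatorname{mod}\mathcal X)\to\mathbb D^{b}(\operatorname{mod}\Lambda)$ be the triangle functor given by applying $e$ termwise, let $\mathbb D^{b}_{0}(\operatorname{mod}\mathcal X)$ be its kernel (the full subcategory of the objects that it sends to zero objects), and let $$\widetilde{\mathbb D^{b}_{e}}:\ \mathbb D^{b}(\operatorname{mod}\mathcal X)/\mathbb D^{b}_{0}(\operatorname{mod}\mathcal X)\longrightarrow \mathbb D^{b}(\operatorname{mod}\Lambda)$$ be the induced functor. Let $\mathbb K^{b}_{\Lambda\text{-}\rm ac}(\operatorname{mod}\mathcal X)$ be the full subcategory of $\mathbb K^{b}(\operatorname{mod}\mathcal X)$ of the complexes $\mathbf F$ for which $\mathbf F(\Lambda)$ is an acyclic complex of abelian groups, let $$\Psi:\ \mathbb K^{b}(\operatorname{mod}\mathcal X)/\mathbb K^{b}_{\Lambda\text{-}\rm ac}(\operatorname{mod}\mathcal X)\longrightarrow \mathbb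 D^{b}(\operatorname{mod}\mathcal X)/\mathbb D^{b}_{0}(\operatorname{mod}\mathcal X)$$ be the functor induced by the identity of $\mathbb K^{b}(\operatorname{mod}\mathcal X)$, and let $\widetilde e=\widetilde{\mathbb D^{b}_{e}}\circ\Psi$, the functor given by applying $e$ termwise. Then $\widetilde e:\ \mathbb K^{b}(\operatorname{mod}\mathcal X)/\mathbb K^{b}_{\Lambda\text{-}\rm ac}(\operatorname{mod}\mathcal X)\to\mathbb D^{b}(\operatorname{mod}\Lambda)$ is an equivalence of triangulated categories, and so is $\widetilde{\mathbb D^{b}_{e}}:\ \mathbb D^{b}(\operatorname{mod}\mathcal X)/\mathbb D^{b}_{0}(\operatorname{mod}\mathcal X)\to\mathbb D^{b}(\operatorname{mod}\Lambda)$. -/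

import Mathlib

namespace RelativeAuslander

open CategoryTheory Limits Opposite ZeroObject Pretriangulated

universe w v u

/-- A presentation of a functor `F : Cᵒᵖ ⥤ Ab` by representable functors: an exact sequence
`C(-, X₁) ⟶ C(-, X₀) ⟶ F ⟶ 0`, the first map being composition with `d : X₁ ⟶ X₀`. -/
structure ProjPresentation {C : Type u} [Category.{v} C] [Preadditive C]
    (F : Cᵒᵖ ⥤ AddCommGrpCat.{v}) where
  X₁ : C
  X₀ : C
  d : X₁ ⟶ X₀
  π : preadditiveYoneda.obj X₀ ⟶ F
  surjective (Z : Cᵒᵖ) : Function.Surjective (π.app Z)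
  exact (Z : Cᵒᵖ) : Function.Exact ((preadditiveYoneda.map d).app Z) (π.app Z)

/-- `mod C`: the additive functors `Cᵒᵖ ⥤ Ab` that are finitely presented, i.e. have a presentation
by representable functors. -/
def finPres (C : Type u) [Category.{v} C] [Preadditive C] :
    ObjectProperty (Cᵒᵖ ⥤ AddCommGrpCat.{v}) :=
  fun F => F.Additive ∧ Nonempty (ProjPresentation F)

section
variable {C : Type u} [Category.{v} C] [Preadditive C] {F G : Cᵒᵖ ⥤ AddCommGrpCat.{v}}

/-- The map `C(Z, X₀) → F(Z)` of a presentation of `F`. -/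
def ProjPresentation.ev (p : ProjPresentation F) (Z : C) : (Z ⟶ p.X₀) →+ F.obj (op Z) :=
  (p.π.app (op Z)).hom

theorem ProjPresentation.ev_comp (p : ProjPresentation F) {Z Z' : C} (h : Z' ⟶ Z) (g : Z ⟶ p.X₀) :
    p.ev Z' (h ≫ g) = F.map h.op (p.ev Z g) :=
  ConcreteCategory.congr_hom (p.π.naturality h.op) g

theorem ProjPresentation.ev_surj (p : ProjPresentation F) (Z : C) (x : F.obj (op Z)) :
    ∃ g, p.ev Z g = x := p.surjective (op Z) x

theorem ProjPresentation.ev_eq_zero_iff (p : ProjPresentation F) {Z : C} (g : Z ⟶ p.X₀) :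
    p.ev Z g = 0 ↔ ∃ h : Z ⟶ p.X₁, h ≫ p.d = g := p.exact (op Z) g

theorem nat_app (f : F ⟶ G) {Z Z' : C} (h : Z' ⟶ Z) (x : F.obj (op Z)) :
    f.app (op Z') (F.map h.op x) = G.map h.op (f.app (op Z) x) :=
  ConcreteCategory.congr_hom (f.naturality h.op) x

/-- A lift of a natural transformation to the degree zero terms of presentations. -/
theorem ProjPresentation.exists_lift (p : ProjPresentation F) (q : ProjPresentation G)
    (f : F ⟶ G) : ∃ f₀ : p.X₀ ⟶ q.X₀, ∀ (Z : C) (g : Z ⟶ p.X₀),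
      q.ev Z (g ≫ f₀) = f.app (op Z) (p.ev Z g) := by
  obtain ⟨f₀, hf⟩ := q.ev_surj p.X₀ (f.app _ (p.ev _ (𝟙 _)))
  refine ⟨f₀, fun Z g => ?_⟩
  rw [q.ev_comp, hf, ← nat_app, ← p.ev_comp, Category.comp_id]

end

section
variable {A : Type u} [Category.{v} A] [Abelian A]

/-- The full subcategory `X` of `A` is contravariantly finite: every object `M` of `A` has a right
`X`-approximation, i.e. a morphism `X₀ ⟶ M` with `X₀` in `X` through which every morphism from an
object of `X` to `M` factors. -/
class ContravariantlyFinite (X : ObjectProperty A) : Prop where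
  exists_approx (M : A) : ∃ (X₀ : A) (_ : X X₀) (φ : X₀ ⟶ M),
    ∀ (Z : A), X Z → ∀ g : Z ⟶ M, ∃ h : Z ⟶ X₀, h ≫ φ = g

variable {X : ObjectProperty A} [ContravariantlyFinite X]

theorem finPres_of_data (F : X.FullSubcategoryᵒᵖ ⥤ AddCommGrpCat.{v}) {M₁ M₀ : A} (d : M₁ ⟶ M₀)
    (π : ∀ Z : X.FullSubcategory, (Z.obj ⟶ M₀) →+ F.obj (op Z))
    (nat : ∀ {Z Z' : X.FullSubcategory} (h : Z' ⟶ Z) (g : Z.obj ⟶ M₀),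
      π Z' (h.hom ≫ g) = F.map h.op (π Z g))
    (surj : ∀ Z (x : F.obj (op Z)), ∃ g, π Z g = x)
    (exact : ∀ Z (g : Z.obj ⟶ M₀), π Z g = 0 ↔ ∃ h : Z.obj ⟶ M₁, h ≫ d = g) :
    finPres X.FullSubcategory F := by
  obtain ⟨X₀, hX₀, a, ha⟩ := ContravariantlyFinite.exists_approx (X := X) M₀
  obtain ⟨X₁, hX₁, b, hb⟩ := ContravariantlyFinite.exists_approx (X := X) (pullback a d)
  refine ⟨⟨fun {Z Z' f g} => ?_⟩, ⟨⟨⟨X₁, hX₁⟩, ⟨X₀, hX₀⟩, ObjectProperty.homMk (b ≫ pullback.fst a d),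
    { app := fun Z => AddCommGrpCat.ofHom
        ((π Z.unop).comp
          { toFun := fun (g : Z.unop ⟶ ⟨X₀, hX₀⟩) => g.hom ≫ a
            map_zero' := zero_comp
            map_add' := fun _ _ => Preadditive.add_comp _ _ _ _ _ _ })
      naturality := ?_ }, ?_, ?_⟩⟩⟩
  · ext x
    obtain ⟨y, rfl⟩ := surj _ x
    change F.map (f + g).unop.op (π _ y) = F.map f.unop.op (π _ y) + F.map g.unop.op (π _ y)
    rw [← nat, ← nat, ← nat, ← map_add]
    exact congrArg _ (Preadditive.add_comp _ _ _ f.unop.hom g.unop.hom y)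
  · intro Z Z' h
    ext g
    change Z.unop ⟶ ⟨X₀, hX₀⟩ at g
    change π Z'.unop ((h.unop.hom ≫ g.hom) ≫ a) = F.map h.unop.op (π _ (g.hom ≫ a))
    rw [← nat, Category.assoc]
  · intro Z x
    obtain ⟨g, hg⟩ := surj Z.unop x
    obtain ⟨h, rfl⟩ := ha _ Z.unop.property g
    exact ⟨ObjectProperty.homMk h, hg⟩
  · intro Z g
    change Z.unop ⟶ ⟨X₀, hX₀⟩ at g
    change π Z.unop (g.hom ≫ a) = 0 ↔ _
    rw [exact]
    constructor
    · rintro ⟨h, hh⟩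
      obtain ⟨k, hk⟩ := hb _ Z.unop.property (pullback.lift g.hom h hh.symm)
      refine ⟨ObjectProperty.homMk k, ?_⟩
      apply ObjectProperty.hom_ext
      change k ≫ b ≫ pullback.fst a d = g.hom
      rw [← Category.assoc, hk, pullback.lift_fst]
    · rintro ⟨k, rfl⟩
      change Z.unop ⟶ ⟨X₁, hX₁⟩ at k
      refine ⟨k.hom ≫ b ≫ pullback.snd a d, ?_⟩
      change _ = (k.hom ≫ b ≫ pullback.fst a d) ≫ a
      simp [pullback.condition]

theorem exact_app {C : Type u} [Category.{v} C] {S : ShortComplex (Cᵒᵖ ⥤ AddCommGrpCat.{w})}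
    (hS : S.Exact) (Z : Cᵒᵖ) : Function.Exact (S.f.app Z) (S.g.app Z) :=
  (ShortComplex.ab_exact_iff_function_exact _).1 (hS.map ((evaluation _ _).obj Z))

theorem injective_app {C : Type u} [Category.{v} C] {F G : Cᵒᵖ ⥤ AddCommGrpCat.{w}} (f : F ⟶ G)
    [Mono f] (Z : Cᵒᵖ) : Function.Injective (f.app Z) :=
  (AddCommGrpCat.mono_iff_injective _).1 inferInstance

theorem surjective_app {C : Type u} [Category.{v} C] {F G : Cᵒᵖ ⥤ AddCommGrpCat.{w}} (f : F ⟶ G)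
    [Epi f] (Z : Cᵒᵖ) : Function.Surjective (f.app Z) :=
  (AddCommGrpCat.epi_iff_surjective _).1 inferInstance

instance : (finPres X.FullSubcategory).IsClosedUnderKernels where
  kernels_le := by
    rintro _ ⟨f, k, hk, ⟨⟨_, ⟨p⟩⟩, ⟨_, ⟨q⟩⟩⟩⟩
    obtain ⟨f₀, hf⟩ := p.exists_lift q f
    have : Mono k.ι := Fork.IsLimit.mono hk
    have hinj := injective_app k.ι
    have hex := exact_app (ShortComplex.exact_of_f_is_kernel (ShortComplex.mk k.ι f k.condition)
      (hk.ofIsoLimit (Fork.ext (Iso.refl _))))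
    let P := pullback f₀.hom q.d.hom
    have key : ∀ (Z : X.FullSubcategory) (g : Z.obj ⟶ P), f.app (op Z)
        (p.ev Z (ObjectProperty.homMk (g ≫ pullback.fst _ _))) = 0 := fun Z g => by
      rw [← hf, q.ev_eq_zero_iff]
      exact ⟨ObjectProperty.homMk (g ≫ pullback.snd _ _),
        ObjectProperty.hom_ext _ (by simp [pullback.condition])⟩
    choose π hπ using fun Z g => (hex (op Z) _).1 (key Z g)
    refine finPres_of_data _ (pullback.fst (pullback.fst f₀.hom q.d.hom) p.d.hom)
      (fun Z => AddMonoidHom.mk' (π Z) fun a b => ?_) (fun {Z Z'} h g => ?_) (fun Z x => ?_)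
      (fun Z g => ?_)
    · apply hinj
      rw [map_add, hπ, hπ, hπ, ← map_add]
      exact congrArg (fun t => p.ev Z t) (ObjectProperty.hom_ext _ (Preadditive.add_comp _ _ _ _ _ _))
    · apply hinj
      change k.ι.app _ (π Z' _) = k.ι.app _ (k.pt.map h.op (π Z g))
      rw [nat_app, hπ, hπ, ← p.ev_comp]
      exact congrArg (fun t => p.ev Z' t) (ObjectProperty.hom_ext _ (Category.assoc _ _ _))
    · obtain ⟨g, hg⟩ := p.ev_surj Z (k.ι.app _ x)
      have h0 : f.app (op Z) (k.ι.app (op Z) x) = 0 := (hex (op Z)).apply_apply_eq_zero x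
      rw [← hg, ← hf, q.ev_eq_zero_iff] at h0
      obtain ⟨h, hh⟩ := h0
      refine ⟨pullback.lift g.hom h.hom (congrArg (fun t => t.hom) hh.symm), hinj _ ?_⟩
      change k.ι.app _ (π Z _) = _
      rw [hπ, ← hg]
      exact congrArg (fun t => p.ev Z t) (ObjectProperty.hom_ext _ (pullback.lift_fst _ _ _))
    · change π Z g = 0 ↔ _
      rw [← (hinj (op Z)).eq_iff, map_zero, hπ, p.ev_eq_zero_iff]
      constructor
      · rintro ⟨h, hh⟩
        exact ⟨pullback.lift g h.hom (congrArg (fun t => t.hom) hh.symm), pullback.lift_fst _ _ _⟩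
      · rintro ⟨h, rfl⟩
        exact ⟨ObjectProperty.homMk (h ≫ pullback.snd _ _),
          ObjectProperty.hom_ext _ (by simp [pullback.condition])⟩

instance : (finPres X.FullSubcategory).IsClosedUnderCokernels where
  cokernels_le := by
    rintro _ ⟨f, k, hk, ⟨⟨_, ⟨p⟩⟩, ⟨_, ⟨q⟩⟩⟩⟩
    obtain ⟨f₀, hf⟩ := p.exists_lift q f
    have : Epi k.π := Cofork.IsColimit.epi hk
    have hsurj := surjective_app k.π
    have hex := exact_app (ShortComplex.exact_of_g_is_cokernel (ShortComplex.mk f k.π k.condition)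
      (hk.ofIsoColimit (Cofork.ext (Iso.refl _))))
    refine finPres_of_data _ (biprod.desc q.d.hom f₀.hom)
      (fun Z => AddMonoidHom.mk' (fun g => k.π.app (op Z) (q.ev Z (ObjectProperty.homMk g)))
        fun a b => ?_) (fun {Z Z'} h g => ?_) (fun Z x => ?_) (fun Z g => ?_)
    · rw [← map_add, ← map_add]
      rfl
    · change k.π.app _ _ = k.pt.map h.op (k.π.app _ _)
      rw [← nat_app, ← q.ev_comp]
      rfl
    · obtain ⟨y, rfl⟩ := hsurj _ x
      obtain ⟨g, rfl⟩ := q.ev_surj Z y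
      exact ⟨g.hom, rfl⟩
    · change k.π.app (op Z) (q.ev Z (ObjectProperty.homMk g)) = 0 ↔ _
      rw [show k.π.app (op Z) (q.ev Z (ObjectProperty.homMk g)) = 0 ↔ _ from hex (op Z) _]
      constructor
      · rintro ⟨y, hy⟩
        obtain ⟨g', rfl⟩ := p.ev_surj Z y
        change f.app (op Z) _ = _ at hy
        rw [← hf, ← sub_eq_zero, ← map_sub, ← neg_eq_zero, ← map_neg, q.ev_eq_zero_iff] at hy
        obtain ⟨h, hh⟩ := hy
        refine ⟨biprod.lift h.hom g'.hom, ?_⟩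
        have hh' : h.hom ≫ q.d.hom = -(g'.hom ≫ f₀.hom - g) := congrArg (fun t => t.hom) hh
        rw [biprod.lift_desc, hh']
        abel
      · rintro ⟨h, rfl⟩
        refine ⟨p.ev Z (ObjectProperty.homMk (h ≫ biprod.snd)), ?_⟩
        change f.app (op Z) _ = _
        rw [← hf, ← sub_eq_zero, ← map_sub, ← neg_eq_zero, ← map_neg, q.ev_eq_zero_iff]
        refine ⟨ObjectProperty.homMk (h ≫ biprod.fst), ObjectProperty.hom_ext _ ?_⟩
        change (h ≫ biprod.fst) ≫ q.d.hom =
          -((h ≫ biprod.snd) ≫ f₀.hom - h ≫ biprod.desc q.d.hom f₀.hom)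
        rw [biprod.desc_eq, Preadditive.comp_add]
        simp

instance : (finPres X.FullSubcategory).ContainsZero where
  exists_zero := by
    refine ⟨0, isZero_zero _, ?_⟩
    have hz (Z : X.FullSubcategory) (x : (0 : X.FullSubcategoryᵒᵖ ⥤ AddCommGrpCat.{v}).obj (op Z)) :
        x = 0 := by
      have : IsZero ((0 : X.FullSubcategoryᵒᵖ ⥤ AddCommGrpCat.{v}).obj (op Z)) :=
        Functor.map_isZero ((evaluation _ _).obj (op Z)) (isZero_zero _)
      have := AddCommGrpCat.subsingleton_of_isZero this
      exact Subsingleton.elim _ _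
    refine finPres_of_data _ (𝟙 (0 : A)) (fun Z => 0) (fun h g => by simp) (fun Z x => ?_)
      fun Z g => ?_
    · exact ⟨0, by simp [hz Z x]⟩
    · exact ⟨fun _ => ⟨0, (isZero_zero A).eq_of_tgt _ _⟩, fun _ => rfl⟩

instance : (finPres X.FullSubcategory).IsClosedUnderIsomorphisms where
  of_iso {F G} e := by
    rintro ⟨_, ⟨p⟩⟩
    refine ⟨Functor.additive_of_iso e, ⟨⟨p.X₁, p.X₀, p.d, p.π ≫ e.hom, fun Z => ?_, fun Z x => ?_⟩⟩⟩
    · exact (surjective_app e.hom Z).comp (p.surjective Z)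
    · rw [← p.exact]
      change e.hom.app Z (p.π.app Z x) = 0 ↔ _
      exact map_eq_zero_iff _ (injective_app e.hom Z)

theorem isClosedUnderFiniteProducts_of_biprod {D : Type*} [Category* D] [Abelian D]
    (P : ObjectProperty D) [P.ContainsZero] [P.IsClosedUnderIsomorphisms]
    (h : ∀ M N, P M → P N → P (M ⊞ N)) : P.IsClosedUnderFiniteProducts := by
  have : P.IsClosedUnderBinaryProducts :=
    ⟨by
      rintro M ⟨p⟩
      exact P.prop_of_iso ((HasLimit.isoOfNatIso (diagramIsoPair p.diag) ≪≫
        (biprod.isoProd _ _).symm).symm ≪≫ (limit.isLimit _).conePointUniqueUpToIso p.isLimit)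
        (h _ _ (p.prop_diag_obj _) (p.prop_diag_obj _))⟩
  exact .mk'

instance : (finPres X.FullSubcategory).IsClosedUnderFiniteProducts := by
  refine isClosedUnderFiniteProducts_of_biprod _ ?_
  rintro F G ⟨_, ⟨p⟩⟩ ⟨_, ⟨q⟩⟩
  let i₁ : F ⟶ F ⊞ G := biprod.inl
  let i₂ : G ⟶ F ⊞ G := biprod.inr
  let p₁ : F ⊞ G ⟶ F := biprod.fst
  let p₂ : F ⊞ G ⟶ G := biprod.snd
  have tot (Z) (x : (F ⊞ G).obj (op Z)) :
      i₁.app _ (p₁.app _ x) + i₂.app _ (p₂.app _ x) = x :=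
    ConcreteCategory.congr_hom (NatTrans.congr_app (biprod.total (X := F) (Y := G)) (op Z)) x
  have h₁₁ (Z) (x : F.obj (op Z)) : p₁.app _ (i₁.app _ x) = x :=
    ConcreteCategory.congr_hom (NatTrans.congr_app (biprod.inl_fst (X := F) (Y := G)) (op Z)) x
  have h₂₂ (Z) (x : G.obj (op Z)) : p₂.app _ (i₂.app _ x) = x :=
    ConcreteCategory.congr_hom (NatTrans.congr_app (biprod.inr_snd (X := F) (Y := G)) (op Z)) x
  have h₁₂ (Z) (x : F.obj (op Z)) : p₂.app _ (i₁.app _ x) = 0 :=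
    ConcreteCategory.congr_hom (NatTrans.congr_app (biprod.inl_snd (X := F) (Y := G)) (op Z)) x
  have h₂₁ (Z) (x : G.obj (op Z)) : p₁.app _ (i₂.app _ x) = 0 :=
    ConcreteCategory.congr_hom (NatTrans.congr_app (biprod.inr_fst (X := F) (Y := G)) (op Z)) x
  refine finPres_of_data _ (biprod.map p.d.hom q.d.hom)
    (fun Z => AddMonoidHom.mk' (fun g =>
      i₁.app _ (p.ev Z (ObjectProperty.homMk (g ≫ biprod.fst))) +
      i₂.app _ (q.ev Z (ObjectProperty.homMk (g ≫ biprod.snd)))) fun a b => ?_)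
    (fun {Z Z'} h g => ?_) (fun Z x => ?_) (fun Z g => ?_)
  · have e₁ : (ObjectProperty.homMk ((a + b) ≫ biprod.fst) : Z ⟶ p.X₀) =
      ObjectProperty.homMk (a ≫ biprod.fst) + ObjectProperty.homMk (b ≫ biprod.fst) :=
      ObjectProperty.hom_ext _ (Preadditive.add_comp _ _ _ _ _ _)
    have e₂ : (ObjectProperty.homMk ((a + b) ≫ biprod.snd) : Z ⟶ q.X₀) =
      ObjectProperty.homMk (a ≫ biprod.snd) + ObjectProperty.homMk (b ≫ biprod.snd) :=
      ObjectProperty.hom_ext _ (Preadditive.add_comp _ _ _ _ _ _)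
    rw [e₁, e₂, map_add, map_add, map_add, map_add]
    abel
  · change i₁.app _ _ + i₂.app _ _ = (F ⊞ G).map h.op (i₁.app _ _ + i₂.app _ _)
    rw [map_add, ← nat_app, ← nat_app, ← p.ev_comp, ← q.ev_comp, Category.assoc, Category.assoc]
    rfl
  · obtain ⟨g₁, h₁⟩ := p.ev_surj Z (p₁.app _ x)
    obtain ⟨g₂, h₂⟩ := q.ev_surj Z (p₂.app _ x)
    refine ⟨biprod.lift g₁.hom g₂.hom, ?_⟩
    change i₁.app _ _ + i₂.app _ _ = _
    rw [biprod.lift_fst, biprod.lift_snd]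
    exact (congrArg₂ (fun a b => i₁.app _ a + i₂.app _ b) h₁ h₂).trans (tot Z x)
  · change i₁.app _ _ + i₂.app _ _ = _ ↔ _
    constructor
    · intro h
      have a₁ := congrArg (p₁.app _) h
      have a₂ := congrArg (p₂.app _) h
      rw [map_add, h₁₁, h₂₁, add_zero, map_zero, p.ev_eq_zero_iff] at a₁
      rw [map_add, h₁₂, h₂₂, zero_add, map_zero, q.ev_eq_zero_iff] at a₂
      obtain ⟨u, hu⟩ := a₁
      obtain ⟨w, hw⟩ := a₂
      refine ⟨biprod.lift u.hom w.hom, ?_⟩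
      apply biprod.hom_ext
      · simpa using congrArg (fun t => t.hom) hu
      · simpa using congrArg (fun t => t.hom) hw
    · rintro ⟨h, rfl⟩
      rw [(p.ev_eq_zero_iff _).2 ⟨ObjectProperty.homMk (h ≫ biprod.fst),
        ObjectProperty.hom_ext _ (by simp)⟩, (q.ev_eq_zero_iff _).2
        ⟨ObjectProperty.homMk (h ≫ biprod.snd), ObjectProperty.hom_ext _ (by simp)⟩,
        map_zero, map_zero, add_zero]

end

section
variable {A : Type u} [Category.{v} A] [Abelian A] (X : ObjectProperty A)

/-- The category `mod X` of finitely presented functors on the full subcategory `X` of `A`. -/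
abbrev FPMod := (finPres X.FullSubcategory).FullSubcategory

variable {X}

/-- A chosen presentation of an object of `mod X`. -/
noncomputable def FPMod.pres (F : FPMod X) : ProjPresentation F.obj := F.property.2.some

section
variable {F G : X.FullSubcategoryᵒᵖ ⥤ AddCommGrpCat.{v}}
  (p : ProjPresentation F) (q : ProjPresentation G) (f : F ⟶ G)

theorem ProjPresentation.d_comp_lift {f₀ : p.X₀ ⟶ q.X₀}
    (hf : ∀ (Z : X.FullSubcategory) (g : Z ⟶ p.X₀), q.ev Z (g ≫ f₀) = f.app (op Z) (p.ev Z g)) :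
    p.d.hom ≫ f₀.hom ≫ cokernel.π q.d.hom = 0 := by
  have h : q.ev _ (p.d ≫ f₀) = 0 := by
    rw [hf, (p.ev_eq_zero_iff _).2 ⟨𝟙 _, Category.id_comp _⟩, map_zero]
  obtain ⟨h, hh⟩ := (q.ev_eq_zero_iff _).1 h
  have hh' : h.hom ≫ q.d.hom = p.d.hom ≫ f₀.hom := congrArg (fun t => t.hom) hh
  rw [← Category.assoc, ← hh', Category.assoc, cokernel.condition, comp_zero]

theorem ProjPresentation.lift_comp_π_eq {f₀ f₁ : p.X₀ ⟶ q.X₀}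
    (h₀ : ∀ (Z : X.FullSubcategory) (g : Z ⟶ p.X₀), q.ev Z (g ≫ f₀) = f.app (op Z) (p.ev Z g))
    (h₁ : ∀ (Z : X.FullSubcategory) (g : Z ⟶ p.X₀), q.ev Z (g ≫ f₁) = f.app (op Z) (p.ev Z g)) :
    f₀.hom ≫ cokernel.π q.d.hom = f₁.hom ≫ cokernel.π q.d.hom := by
  have h : q.ev _ (f₀ - f₁) = 0 := by
    rw [map_sub, ← Category.id_comp f₀, ← Category.id_comp f₁, h₀, h₁, sub_self]
  obtain ⟨h, hh⟩ := (q.ev_eq_zero_iff _).1 h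
  have hh' : h.hom ≫ q.d.hom = f₀.hom - f₁.hom := congrArg (fun t => t.hom) hh
  rw [← sub_eq_zero, ← Preadditive.sub_comp, ← hh', Category.assoc, cokernel.condition, comp_zero]

/-- The map induced on the cokernels in `A` of the morphisms `X₁ ⟶ X₀` of two presentations by a
morphism of functors (through any lift of it to the presentations). -/
noncomputable def ProjPresentation.cokernelMap : cokernel p.d.hom ⟶ cokernel q.d.hom :=
  cokernel.desc _ ((p.exists_lift q f).choose.hom ≫ cokernel.π _)
    (p.d_comp_lift q f (p.exists_lift q f).choose_spec)

theorem ProjPresentation.π_cokernelMap {f₀ : p.X₀ ⟶ q.X₀}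
    (h₀ : ∀ (Z : X.FullSubcategory) (g : Z ⟶ p.X₀), q.ev Z (g ≫ f₀) = f.app (op Z) (p.ev Z g)) :
    cokernel.π p.d.hom ≫ p.cokernelMap q f = f₀.hom ≫ cokernel.π q.d.hom := by
  rw [cokernelMap, cokernel.π_desc]
  exact p.lift_comp_π_eq q f (p.exists_lift q f).choose_spec h₀

end

variable (X) in
/-- The functor `e : mod X ⥤ A`: it sends `F`, presented by `X(-, X₁) ⟶ X(-, X₀) ⟶ F ⟶ 0`, to the
cokernel of `X₁ ⟶ X₀` in `A`, and a morphism to the map of cokernels given by a lift of it to the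
presentations. -/
noncomputable def functorE : FPMod X ⥤ A where
  obj F := cokernel F.pres.d.hom
  map {F G} f := F.pres.cokernelMap G.pres f.hom
  map_id F := by
    rw [← cancel_epi (cokernel.π _), ProjPresentation.π_cokernelMap (f₀ := 𝟙 _) _ _ _ ?_]
    · simp
    · intro Z g
      simp
  map_comp {F G H} f g := by
    obtain ⟨f₀, hf⟩ := F.pres.exists_lift G.pres f.hom
    obtain ⟨g₀, hg⟩ := G.pres.exists_lift H.pres g.hom
    rw [← cancel_epi (cokernel.π _), ProjPresentation.π_cokernelMap (f₀ := f₀ ≫ g₀) _ _ _ ?_,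
      ← Category.assoc, F.pres.π_cokernelMap G.pres f.hom hf, Category.assoc,
      G.pres.π_cokernelMap H.pres g.hom hg]
    · simp
    · intro Z u
      rw [← Category.assoc, hg, hf]
      rfl

/-- The projection `X₀ ⟶ e(F)`. -/
noncomputable def functorEπ (F : FPMod X) : F.pres.X₀.obj ⟶ (functorE X).obj F := cokernel.π F.pres.d.hom

instance (F : FPMod X) : Epi (functorEπ F) := inferInstanceAs (Epi (cokernel.π F.pres.d.hom))

theorem functorE_exact_pres (F : FPMod X) :
    ∃ w : F.pres.d.hom ≫ functorEπ F = 0, (ShortComplex.mk F.pres.d.hom (functorEπ F) w).Exact :=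
  ⟨cokernel.condition F.pres.d.hom,
    ShortComplex.exact_of_g_is_cokernel _ (cokernelIsCokernel F.pres.d.hom)⟩

theorem functorEπ_map {F G : FPMod X} (f : F ⟶ G) {f₀ : F.pres.X₀ ⟶ G.pres.X₀}
    (h₀ : ∀ (Z : X.FullSubcategory) (g : Z ⟶ F.pres.X₀),
      G.pres.ev Z (g ≫ f₀) = f.hom.app (op Z) (F.pres.ev Z g)) :
    functorEπ F ≫ (functorE X).map f = f₀.hom ≫ functorEπ G :=
  ProjPresentation.π_cokernelMap _ _ _ h₀

instance : (functorE X).Additive where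
  map_add {F G f g} := by
    obtain ⟨f₀, hf⟩ := F.pres.exists_lift G.pres f.hom
    obtain ⟨g₀, hg⟩ := F.pres.exists_lift G.pres g.hom
    rw [← cancel_epi (functorEπ F), Preadditive.comp_add, functorEπ_map f hf, functorEπ_map g hg,
      functorEπ_map (f + g) (f₀ := f₀ + g₀) ?_]
    · exact Preadditive.add_comp _ _ _ _ _ _
    · intro Z u
      rw [Preadditive.comp_add, map_add, hf, hg]
      rfl

theorem functorE_lift (S : ShortComplex (FPMod X)) (Z : X.FullSubcategory) [Projective Z.obj]
    (hZ : Function.Exact (S.f.hom.app (op Z)) (S.g.hom.app (op Z)))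
    (y : Z.obj ⟶ (functorE X).obj S.X₂) (hy : y ≫ (functorE X).map S.g = 0) :
    ∃ x : Z.obj ⟶ (functorE X).obj S.X₁, x ≫ (functorE X).map S.f = y := by
  obtain ⟨f₀, hf⟩ := S.X₁.pres.exists_lift S.X₂.pres S.f.hom
  obtain ⟨g₀, hg⟩ := S.X₂.pres.exists_lift S.X₃.pres S.g.hom
  let u : Z.obj ⟶ S.X₂.pres.X₀.obj := Projective.factorThru y (functorEπ _)
  have hu : u ≫ functorEπ S.X₂ = y := Projective.factorThru_comp _ _
  have hu' : (u ≫ g₀.hom) ≫ functorEπ S.X₃ = 0 := by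
    rw [Category.assoc, ← functorEπ_map S.g hg, ← Category.assoc, hu, hy]
  obtain ⟨_, hex⟩ := functorE_exact_pres S.X₃
  have h₀ : S.g.hom.app (op Z) (S.X₂.pres.ev Z (ObjectProperty.homMk u)) = 0 := by
    rw [← hg, ProjPresentation.ev_eq_zero_iff]
    exact ⟨ObjectProperty.homMk (hex.liftFromProjective _ hu'),
      ObjectProperty.hom_ext _ (hex.liftFromProjective_comp _ hu')⟩
  obtain ⟨x, hx⟩ := (hZ _).1 h₀
  obtain ⟨k, rfl⟩ := S.X₁.pres.ev_surj Z x
  rw [← hf, ← sub_eq_zero, ← map_sub, ProjPresentation.ev_eq_zero_iff] at hx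
  obtain ⟨h, hh⟩ := hx
  have hh' : h.hom ≫ S.X₂.pres.d.hom = k.hom ≫ f₀.hom - u := congrArg (fun t => t.hom) hh
  obtain ⟨w, _⟩ := functorE_exact_pres S.X₂
  refine ⟨k.hom ≫ functorEπ S.X₁, ?_⟩
  rw [← hu, Category.assoc, functorEπ_map S.f hf, ← sub_eq_zero, ← Category.assoc,
    ← Preadditive.sub_comp, ← hh', Category.assoc, w, comp_zero]

/-- Every object of the ambient abelian category is a quotient of a projective object that
lies in `X`. -/
class HasEnoughProjectivesIn (X : ObjectProperty A) : Prop where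
  exists_epi (M : A) : ∃ (P : A) (_ : X P) (_ : Projective P) (π : P ⟶ M), Epi π

variable [ContravariantlyFinite X]

theorem exact_app_FPMod {S : ShortComplex (FPMod X)} (hS : S.Exact) (Z : X.FullSubcategoryᵒᵖ) :
    Function.Exact (S.f.hom.app Z) (S.g.hom.app Z) := by
  have : (finPres X.FullSubcategory).ι.PreservesHomology :=
    { preservesKernels := fun _ _ f => ObjectProperty.preservesKernels_ι _ f
      preservesCokernels := fun _ _ f => ObjectProperty.preservesCokernels_ι _ f }
  exact exact_app (hS.map (finPres X.FullSubcategory).ι) Z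

variable [HasEnoughProjectivesIn X]

theorem functorE_map_exact (S : ShortComplex (FPMod X)) (hS : S.Exact) :
    (S.map (functorE X)).Exact := by
  rw [ShortComplex.exact_iff_exact_up_to_refinements]
  intro M y hy
  obtain ⟨P, hP, _, r, _⟩ := HasEnoughProjectivesIn.exists_epi (X := X) M
  have : Projective (⟨P, hP⟩ : X.FullSubcategory).obj := ‹Projective P›
  obtain ⟨x, hx⟩ := functorE_lift S ⟨P, hP⟩ (exact_app_FPMod hS _) (r ≫ y)
    ((Category.assoc _ _ _).trans ((congrArg (r ≫ ·) hy).trans comp_zero))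
  exact ⟨P, r, inferInstance, x, hx.symm⟩

theorem functorE_exact : PreservesFiniteLimits (functorE X) ∧ PreservesFiniteColimits (functorE X) :=
  ((functorE X).exact_tfae.out 1 3).1 functorE_map_exact

instance : PreservesFiniteLimits (functorE X) := functorE_exact.1
instance : PreservesFiniteColimits (functorE X) := functorE_exact.2
end
section Verdier
variable {T T' : Type*} [Category* T] [Category* T']
  [HasZeroObject T] [HasShift T ℤ] [Preadditive T] [∀ n : ℤ, (shiftFunctor T n).Additive]
  [Pretriangulated T] [IsTriangulated T]
  [HasZeroObject T'] [HasShift T' ℤ] [Preadditive T'] [∀ n : ℤ, (shiftFunctor T' n).Additive]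
  [Pretriangulated T']

instance isTriangulated_isZero : ObjectProperty.IsTriangulated (IsZero (C := T)) where
  exists_zero := ⟨0, isZero_zero _, isZero_zero _⟩
  isStableUnderShiftBy n := ⟨fun X hX => (shiftFunctor T n).map_isZero hX⟩
  ext₂' D hD h₁ h₃ := ⟨D.obj₂, Triangle.isZero₂_of_isZero₁₃ D hD h₁ h₃, ⟨Iso.refl _⟩⟩

instance isTriangulated_kernel (F : T ⥤ T') [F.CommShift ℤ] [F.IsTriangulated] : F.kernel.IsTriangulated :=
  inferInstanceAs (ObjectProperty.inverseImage (IsZero (C := T')) F).IsTriangulated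

/-- The Verdier quotient `T/P`: the localization of `T` at the morphisms with a cone in `P`. -/
abbrev VerdierQuotient (P : ObjectProperty T) [P.IsTriangulated] := P.trW.Localization

/-- The quotient functor `T ⥤ T/P`. -/
abbrev verdierQ (P : ObjectProperty T) [P.IsTriangulated] : T ⥤ VerdierQuotient P := P.trW.Q

variable (P : ObjectProperty T) [P.IsTriangulated] (F : T ⥤ T') [F.CommShift ℤ] [F.IsTriangulated]

theorem trW_isInvertedBy (h : P ≤ F.kernel) : P.trW.IsInvertedBy F := by
  intro X Y f hf
  obtain ⟨Z, g, k, hT, hZ⟩ := (P.trW_iff f).1 hf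
  have := F.map_distinguished _ hT
  exact (Triangle.isZero₃_iff_isIso₁ _ this).1 (h _ hZ)

variable (h : P ≤ F.kernel)

/-- The functor `T/P ⥤ T'` induced by a triangle functor `F : T ⥤ T'` that annihilates `P`. -/
noncomputable def verdierLift : VerdierQuotient P ⥤ T' :=
  Localization.lift F (trW_isInvertedBy P F h) P.trW.Q

/-- The induced functor extends `F` along the quotient functor. -/
noncomputable def verdierLiftFac : verdierQ P ⋙ verdierLift P F h ≅ F :=
  Localization.fac F (trW_isInvertedBy P F h) P.trW.Q

noncomputable instance : Localization.Lifting (verdierQ P) P.trW F (verdierLift P F h) :=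
  ⟨verdierLiftFac P F h⟩

noncomputable instance verdierLiftCommShift : (verdierLift P F h).CommShift ℤ :=
  Functor.commShiftOfLocalization (verdierQ P) P.trW ℤ F (verdierLift P F h)

instance : NatTrans.CommShift (verdierLiftFac P F h).hom ℤ :=
  inferInstanceAs (NatTrans.CommShift
    (Localization.Lifting.iso (verdierQ P) P.trW F (verdierLift P F h)).hom ℤ)

instance verdierLift_isTriangulated : (verdierLift P F h).IsTriangulated := by
  have := Localization.essSurj_mapArrow (verdierQ P) P.trW
  exact Functor.isTriangulated_of_precomp_iso (verdierLiftFac P F h)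

end Verdier

section
open HomologicalComplex
variable (C D : Type*) [Category* C] [Category* D] [Preadditive C] [Preadditive D]

/-- The bounded complexes, in the homotopy category of cochain complexes. -/
def boundedComplexes : ObjectProperty (HomotopyCategory C (.up ℤ)) :=
  fun K => ∃ a b : ℤ, ∀ i : ℤ, (i < a ∨ b < i) → IsZero (K.as.X i)

instance [HasZeroObject C] : (boundedComplexes C).ContainsZero where
  exists_zero :=
    ⟨(HomotopyCategory.quotient _ _).obj 0, Functor.map_isZero _ (isZero_zero _),
      0, 0, fun i _ => (HomologicalComplex.eval C (.up ℤ) i).map_isZero (isZero_zero _)⟩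

instance : (boundedComplexes C).IsStableUnderShift ℤ where
  isStableUnderShiftBy n :=
    { le_shift K hK := by
        obtain ⟨a, b, h⟩ := hK
        refine ⟨a - n, b - n, fun i hi => ?_⟩
        obtain ⟨K : CochainComplex _ _, rfl⟩ := K.quotient_obj_surjective
        rw [HomotopyCategory.shift_quotient_obj]
        exact h (i + n) (by lia) }

instance [HasZeroObject C] [HasBinaryBiproducts C] :
    (boundedComplexes C).IsTriangulatedClosed₃ where
  ext₃' T hT h₁ h₂ := by
    obtain ⟨a₁, b₁, h₁⟩ := h₁
    obtain ⟨a₂, b₂, h₂⟩ := h₂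
    obtain ⟨f : T.obj₁.as ⟶ T.obj₂.as, hf⟩ :=
      (HomotopyCategory.quotient _ _).map_surjective T.mor₁
    refine ⟨(HomotopyCategory.quotient _ _).obj (CochainComplex.mappingCone f), ?_,
      ⟨Triangle.π₃.mapIso (isoTriangleOfIso₁₂ T _ hT
        (HomotopyCategory.mappingCone_triangleh_distinguished f)
        (Iso.refl _) (Iso.refl _)
        ((Category.comp_id _).trans (hf.symm.trans (Category.id_comp _).symm)))⟩⟩
    refine ⟨min (a₁ - 1) a₂, max b₁ b₂, fun i hi => ?_⟩
    change IsZero ((CochainComplex.mappingCone f).X i)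
    rw [CochainComplex.mappingCone.isZero_X_iff]
    exact ⟨h₁ _ (by grind), h₂ _ (by grind)⟩

instance [HasZeroObject C] [HasBinaryBiproducts C] : (boundedComplexes C).IsTriangulated where
  toIsTriangulatedClosed₂ := .of_isTriangulatedClosed₃

/-- The bounded homotopy category `K^b(C)`. -/
abbrev Kb := (boundedComplexes C).FullSubcategory

variable {C D}

/-- The functor `K^b(C) ⥤ K^b(D)` given by applying an additive functor termwise. -/
noncomputable def mapKb (F : C ⥤ D) [F.Additive] : Kb C ⥤ Kb D :=
  (boundedComplexes D).lift
    ((boundedComplexes C).ι ⋙ F.mapHomotopyCategory (.up ℤ)) (by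
      rintro ⟨K, a, b, h⟩
      exact ⟨a, b, fun i hi => F.map_isZero (h i hi)⟩)

noncomputable instance (F : C ⥤ D) [F.Additive] : (mapKb F).CommShift ℤ :=
  inferInstanceAs (((boundedComplexes D).lift ((boundedComplexes C).ι ⋙
    F.mapHomotopyCategory (.up ℤ)) _).CommShift ℤ)

instance (F : C ⥤ D) [F.Additive] [HasZeroObject C] [HasBinaryBiproducts C] [HasZeroObject D]
    [HasBinaryBiproducts D] : (mapKb F).IsTriangulated := by
  exact ObjectProperty.isTriangulated_lift _ _ _
end

section
variable (A B : Type*) [Category* A] [Abelian A] [Category* B] [Abelian B]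

/-- The acyclic complexes in `K^b(A)`. -/
abbrev KbAcyclic : ObjectProperty (Kb A) :=
  (HomotopyCategory.subcategoryAcyclic A).inverseImage (boundedComplexes A).ι

/-- The bounded derived category `D^b(A) = K^b(A)/K^b_ac(A)`. -/
def Db := VerdierQuotient (KbAcyclic A)

noncomputable section
instance : Category (Db A) := inferInstanceAs (Category (VerdierQuotient (KbAcyclic A)))
instance : Preadditive (Db A) := inferInstanceAs (Preadditive (VerdierQuotient (KbAcyclic A)))
instance : HasZeroObject (Db A) := inferInstanceAs (HasZeroObject (VerdierQuotient (KbAcyclic A)))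
instance : HasShift (Db A) ℤ := inferInstanceAs (HasShift (VerdierQuotient (KbAcyclic A)) ℤ)
instance (n : ℤ) : (shiftFunctor (Db A) n).Additive :=
  inferInstanceAs (shiftFunctor (VerdierQuotient (KbAcyclic A)) n).Additive
instance : Pretriangulated (Db A) :=
  inferInstanceAs (Pretriangulated (VerdierQuotient (KbAcyclic A)))
instance : IsTriangulated (Db A) :=
  inferInstanceAs (IsTriangulated (VerdierQuotient (KbAcyclic A)))

/-- The quotient functor `K^b(A) ⥤ D^b(A)`. -/
def DbQ : Kb A ⥤ Db A := verdierQ (KbAcyclic A)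

instance : (DbQ A).CommShift ℤ := inferInstanceAs ((verdierQ (KbAcyclic A)).CommShift ℤ)
instance : (DbQ A).IsTriangulated := inferInstanceAs (verdierQ (KbAcyclic A)).IsTriangulated
instance : (DbQ A).IsLocalization (KbAcyclic A).trW :=
  inferInstanceAs ((verdierQ (KbAcyclic A)).IsLocalization (KbAcyclic A).trW)
end

variable {A} in
theorem kbAcyclic_iff (K : Kb A) : KbAcyclic A K ↔ ∀ n : ℤ, K.obj.as.ExactAt n :=
  HomotopyCategory.quotient_obj_mem_subcategoryAcyclic_iff_exactAt K.obj.as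

theorem isZero_verdierQ {T : Type*} [Category* T]
  [HasZeroObject T] [HasShift T ℤ] [Preadditive T] [∀ n : ℤ, (shiftFunctor T n).Additive]
  [Pretriangulated T] [IsTriangulated T] (P : ObjectProperty T) [P.IsTriangulated] (X : T) (hX : P X) :
    IsZero ((verdierQ P).obj X) := by
  have : P.trW (0 : X ⟶ 0) := by
    refine (P.trW_iff' _).2 ⟨X, 𝟙 X, 0, contractible_distinguished X, hX⟩
  have := Localization.inverts (verdierQ P) P.trW _ this
  exact (Functor.map_isZero (verdierQ P) (isZero_zero T)).of_iso (asIso ((verdierQ P).map (0 : X ⟶ 0)))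

variable {A B}
variable (F : A ⥤ B) [F.Additive] [PreservesFiniteLimits F] [PreservesFiniteColimits F]

theorem KbAcyclic_le : KbAcyclic A ≤ (mapKb F ⋙ DbQ B).kernel := by
  intro K hK
  refine isZero_verdierQ _ _ ((kbAcyclic_iff _).2 fun n => ?_)
  exact ((kbAcyclic_iff _).1 hK n).map F

/-- The functor `D^b(A) ⥤ D^b(B)` induced termwise by an exact functor `A ⥤ B`. -/
noncomputable def mapDb : Db A ⥤ Db B := verdierLift _ (mapKb F ⋙ DbQ B) (KbAcyclic_le F)

noncomputable instance : (mapDb F).CommShift ℤ :=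
  inferInstanceAs ((verdierLift _ (mapKb F ⋙ DbQ B) (KbAcyclic_le F)).CommShift ℤ)

instance : (mapDb F).IsTriangulated :=
  inferInstanceAs ((verdierLift _ (mapKb F ⋙ DbQ B) (KbAcyclic_le F)).IsTriangulated)

/-- `mapDb F` is given by `F` termwise. -/
noncomputable def mapDbFac : DbQ A ⋙ mapDb F ≅ mapKb F ⋙ DbQ B :=
  verdierLiftFac _ _ (KbAcyclic_le F)

end
/-- `Λ` is an artin algebra: a finite algebra over some commutative artinian ring. It is no loss
that the ring is taken in the universe of `Λ`, see `IsArtinAlgebra.of_finite`. -/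
class IsArtinAlgebra (Λ : Type u) [Ring Λ] : Prop where
  exists_finite : ∃ (R : Type u) (_ : CommRing R) (_ : IsArtinianRing R) (_ : Algebra R Λ),
    Module.Finite R Λ

theorem IsArtinAlgebra.of_finite {R : Type v} [CommRing R] [IsArtinianRing R] {Λ : Type u}
    [Ring Λ] [Algebra R Λ] [Module.Finite R Λ] : IsArtinAlgebra Λ := by
  let S : Subalgebra R Λ := ⊥
  have hs : Function.Surjective (algebraMap R S) := by
    rintro ⟨x, hx⟩
    obtain ⟨r, rfl⟩ := Algebra.mem_bot.1 hx
    exact ⟨r, rfl⟩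
  let _ : CommRing S := { (inferInstance : Ring S) with
    mul_comm := by
      intro a b
      obtain ⟨a, rfl⟩ := hs a
      obtain ⟨b, rfl⟩ := hs b
      rw [← map_mul, mul_comm, map_mul] }
  let _ : Algebra S Λ :=
    { S.val.toRingHom with
      smul := fun s x => s.1 * x
      commutes' := by
        rintro s x
        obtain ⟨r, rfl⟩ := hs s
        exact Algebra.commutes r x
      smul_def' := fun _ _ => rfl
      algebraMap := S.val.toRingHom }
  have : IsArtinianRing S := hs.isArtinianRing (f := algebraMap R S)
  have : IsScalarTower R S Λ := IsScalarTower.of_algebraMap_eq fun r => rfl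
  exact ⟨S, inferInstance, inferInstance, inferInstance, Module.Finite.of_restrictScalars_finite R S Λ⟩

instance IsArtinAlgebra.isNoetherianRing_mop (Λ : Type u) [Ring Λ] [h : IsArtinAlgebra Λ] :
    IsNoetherianRing Λᵐᵒᵖ := by
  obtain ⟨R, _, _, _, _⟩ := h.exists_finite
  have : IsNoetherian R Λᵐᵒᵖ := isNoetherian_of_linearEquiv (MulOpposite.opLinearEquiv R (M := Λ))
  exact isNoetherian_of_tower R inferInstance

/-- The finitely presented right `Λ`-modules, i.e. finitely presented modules over `Λᵐᵒᵖ`. -/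
abbrev modFP (Λ : Type u) [Ring Λ] : ObjectProperty (ModuleCat.{u} Λᵐᵒᵖ) :=
  fun M => Module.FinitePresentation Λᵐᵒᵖ M

section
variable (Λ : Type u) [Ring Λ] [IsNoetherianRing Λᵐᵒᵖ]

theorem modFP_iff (M : ModuleCat.{u} Λᵐᵒᵖ) : modFP Λ M ↔ Module.Finite Λᵐᵒᵖ M :=
  ⟨fun (_ : Module.FinitePresentation Λᵐᵒᵖ M) => inferInstance,
   fun _ => Module.finitePresentation_of_finite _ _⟩

instance : (modFP Λ).IsClosedUnderSubobjects where
  prop_of_mono {M N} f _ hN := by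
    rw [modFP_iff] at *
    exact Module.Finite.of_injective f.hom ((ModuleCat.mono_iff_injective f).1 inferInstance)

instance : (modFP Λ).IsClosedUnderQuotients where
  prop_of_epi {M N} f _ hN := by
    rw [modFP_iff] at *
    exact Module.Finite.of_surjective f.hom ((ModuleCat.epi_iff_surjective f).1 inferInstance)

instance : (modFP Λ).ContainsZero where
  exists_zero := ⟨ModuleCat.of Λᵐᵒᵖ PUnit.{u + 1}, ModuleCat.isZero_of_subsingleton _, by
    rw [modFP_iff]; exact inferInstanceAs (Module.Finite Λᵐᵒᵖ PUnit.{u + 1})⟩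

instance : (modFP Λ).IsClosedUnderFiniteProducts :=
  isClosedUnderFiniteProducts_of_biprod _ fun M N hM hN => by
    rw [modFP_iff] at *
    exact Module.Finite.equiv (ModuleCat.biprodIsoProd M N).toLinearEquiv.symm

end

section
variable (Λ : Type u) [Ring Λ] [IsArtinAlgebra Λ]

/-- The abelian category `mod Λ`. -/
abbrev ModCat := (modFP Λ).FullSubcategory

/-- `prj Λ`: the projective modules in `mod Λ`. -/
def prj : ObjectProperty (ModCat Λ) := fun P => Module.Projective Λᵐᵒᵖ P.obj

variable {Λ} in
theorem prj.projective {P : ModCat Λ} (hP : prj Λ P) : Projective P := by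
  have := (modFP Λ).preservesEpimorphisms_ι_of_isNormalMonoCategory
  have hP' : Projective ((modFP Λ).ι.obj P) := (IsProjective.iff_projective _).1 hP
  exact ⟨fun g q _ =>
    ⟨(modFP Λ).fullyFaithfulι.preimage
      (Projective.factorThru ((modFP Λ).ι.map g) ((modFP Λ).ι.map q)),
    (modFP Λ).ι.map_injective (by simp)⟩⟩

theorem exists_prj_epi (M : ModCat Λ) : ∃ (P : ModCat Λ) (_ : prj Λ P) (π : P ⟶ M), Epi π := by
  have : Module.Finite Λᵐᵒᵖ M.obj := (modFP_iff Λ _).1 M.property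
  obtain ⟨n, f, hf⟩ := Module.Finite.exists_fin' Λᵐᵒᵖ M.obj
  let P : ModCat Λ := ⟨ModuleCat.of Λᵐᵒᵖ (Fin n → Λᵐᵒᵖ),
    (modFP_iff Λ _).2 (inferInstanceAs (Module.Finite Λᵐᵒᵖ (Fin n → Λᵐᵒᵖ)))⟩
  have hP : prj Λ P := inferInstanceAs (Module.Projective Λᵐᵒᵖ (Fin n → Λᵐᵒᵖ))
  refine ⟨P, hP, ObjectProperty.homMk (ModuleCat.ofHom f), ?_⟩
  have : Epi ((modFP Λ).ι.map (ObjectProperty.homMk (ModuleCat.ofHom f) : P ⟶ M)) :=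
    (ModuleCat.epi_iff_surjective _).2 hf
  exact (modFP Λ).ι.epi_of_epi_map this

/-- `Λᵐᵒᵖ` and `Λ` are isomorphic as right `Λ`-modules. -/
def opLinearEquivSelf : Λᵐᵒᵖ ≃ₗ[Λᵐᵒᵖ] Λ where
  toFun := MulOpposite.unop
  invFun := MulOpposite.op
  map_add' _ _ := rfl
  map_smul' _ _ := rfl
  left_inv _ := rfl
  right_inv _ := rfl

/-- The right regular module. -/
def regularModule : ModCat Λ :=
  ⟨ModuleCat.of Λᵐᵒᵖ Λ, (modFP_iff Λ _).2 (Module.Finite.equiv (opLinearEquivSelf Λ))⟩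

theorem prj_regularModule : prj Λ (regularModule Λ) :=
  Module.Projective.of_equiv (opLinearEquivSelf Λ)

variable {Λ} in
theorem exact_of_regularModule (S : ShortComplex (ModCat Λ))
    (h : ∀ y : regularModule Λ ⟶ S.X₂, y ≫ S.g = 0 → ∃ x : regularModule Λ ⟶ S.X₁, x ≫ S.f = y) :
    S.Exact := by
  have : (modFP Λ).ι.PreservesHomology :=
    { preservesKernels := fun _ _ f => ObjectProperty.preservesKernels_ι _ f
      preservesCokernels := fun _ _ f => ObjectProperty.preservesCokernels_ι _ f }
  rw [← ShortComplex.exact_map_iff_of_faithful S (modFP Λ).ι, ShortComplex.moduleCat_exact_iff]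
  intro m hm
  change S.g.hom.hom m = 0 at hm
  let l : Λ →ₗ[Λᵐᵒᵖ] S.X₂.obj :=
    (LinearMap.toSpanSingleton Λᵐᵒᵖ S.X₂.obj m).comp (opLinearEquivSelf Λ).symm.toLinearMap
  have hl (a : Λ) : l a = MulOpposite.op a • m := rfl
  obtain ⟨x, hx⟩ := h (ObjectProperty.homMk (ModuleCat.ofHom l)) (by
    apply ObjectProperty.hom_ext
    apply ModuleCat.hom_ext
    refine LinearMap.ext fun (a : Λ) => ?_
    refine (S.g.hom.hom.map_smul (MulOpposite.op a) m).trans ?_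
    rw [hm, smul_zero]
    rfl)
  refine ⟨x.hom.hom (1 : Λ), ?_⟩
  have h1 : S.f.hom.hom (x.hom.hom (1 : Λ)) = l 1 :=
    congrArg (fun t : regularModule Λ ⟶ S.X₂ => t.hom.hom (1 : Λ)) hx
  rw [hl, MulOpposite.op_one, one_smul] at h1
  exact h1

variable {Λ}

/-- The subcategory `X` of `mod Λ` contains `prj Λ`. -/
class ContainsPrj (X : ObjectProperty (ModCat Λ)) : Prop where
  prj_le : prj Λ ≤ X

instance (X : ObjectProperty (ModCat Λ)) [ContainsPrj X] : HasEnoughProjectivesIn X where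
  exists_epi M := by
    obtain ⟨P, hP, π, hπ⟩ := exists_prj_epi Λ M
    exact ⟨P, ContainsPrj.prj_le _ hP, hP.projective, π, hπ⟩

noncomputable instance : Abelian (ModCat Λ) := inferInstance

variable (X : ObjectProperty (ModCat Λ)) [ContravariantlyFinite X] [ContainsPrj X]

noncomputable instance : Abelian (FPMod X) := inferInstance

/-- The derived extension `D^b_e : D^b(mod X) ⥤ D^b(mod Λ)` of `e`. -/
noncomputable abbrev DbE : Db (FPMod X) ⥤ Db (ModCat Λ) := mapDb (functorE X)

/-- `D^b_0(mod X)`: the kernel of `D^b_e`. -/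
def DbZero : ObjectProperty (Db (FPMod X)) := (DbE X).kernel

instance : (DbZero X).IsTriangulated := isTriangulated_kernel (DbE X)

/-- The functor `D^b(mod X)/D^b_0(mod X) ⥤ D^b(mod Λ)` induced by `D^b_e`. -/
noncomputable def DbETilde : VerdierQuotient (DbZero X) ⥤ Db (ModCat Λ) :=
  verdierLift (DbZero X) (DbE X) le_rfl

noncomputable instance : (DbETilde X).CommShift ℤ :=
  verdierLiftCommShift (DbZero X) (DbE X) le_rfl

/-- The right regular module as an object of `X`. -/
def regularObject : X.FullSubcategory :=
  ⟨regularModule Λ, ContainsPrj.prj_le _ (prj_regularModule Λ)⟩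

/-- Evaluation `F ↦ F(Λ)` on `mod X`. -/
noncomputable def evalRegular : FPMod X ⥤ AddCommGrpCat.{u} :=
  (finPres X.FullSubcategory).ι ⋙ (evaluation _ _).obj (op (regularObject X))

instance : (evalRegular X).Additive where
  map_add := rfl

/-- `K^b_{Λ-ac}(mod X)`: the complexes `F` for which the complex `F(Λ)` of abelian groups is acyclic. -/
abbrev KbRegularAcyclic : ObjectProperty (Kb (FPMod X)) :=
  (KbAcyclic AddCommGrpCat.{u}).inverseImage (mapKb (evalRegular X))

theorem kbRegularAcyclic_iff (K : Kb (FPMod X)) :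
    KbRegularAcyclic X K ↔
      ∀ n : ℤ, (((evalRegular X).mapHomologicalComplex (.up ℤ)).obj K.obj.as).ExactAt n :=
  kbAcyclic_iff _

theorem kbRegularAcyclic_le : KbRegularAcyclic X ≤ (DbQ (FPMod X) ⋙ verdierQ (DbZero X)).kernel := by
  intro K hK
  refine isZero_verdierQ _ _ ?_
  have : IsZero ((mapKb (functorE X) ⋙ DbQ (ModCat Λ)).obj K) := by
    refine isZero_verdierQ _ _ ((kbAcyclic_iff _).2 fun n => ?_)
    have : Projective (regularObject X).obj := (prj_regularModule Λ).projective
    have h := (kbRegularAcyclic_iff X K).1 hK n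
    exact exact_of_regularModule _ (functorE_lift (K.obj.as.sc n) (regularObject X)
      ((ShortComplex.ab_exact_iff_function_exact _).1 h))
  exact this.of_iso ((verdierLiftFac _ _ (KbAcyclic_le (functorE X))).app K)

/-- The functor `Ψ : K^b(mod X)/K^b_{Λ-ac}(mod X) ⥤ D^b(mod X)/D^b_0(mod X)` induced by the identity of
`K^b(mod X)`. -/
noncomputable def psi : VerdierQuotient (KbRegularAcyclic X) ⥤ VerdierQuotient (DbZero X) :=
  verdierLift (KbRegularAcyclic X) (DbQ (FPMod X) ⋙ verdierQ (DbZero X)) (kbRegularAcyclic_le X)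

noncomputable instance : (psi X).CommShift ℤ :=
  inferInstanceAs ((verdierLift (KbRegularAcyclic X) (DbQ (FPMod X) ⋙ verdierQ (DbZero X))
    (kbRegularAcyclic_le X)).CommShift ℤ)

/-- The functor `K^b(mod X)/K^b_{Λ-ac}(mod X) ⥤ D^b(mod Λ)` induced termwise by `e`, as the composition
of `Ψ` with the functor induced by `D^b_e`. -/
noncomputable def eTilde : VerdierQuotient (KbRegularAcyclic X) ⥤ Db (ModCat Λ) :=
  psi X ⋙ DbETilde X

noncomputable instance : (eTilde X).CommShift ℤ :=
  inferInstanceAs ((psi X ⋙ DbETilde X).CommShift ℤ)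

end
end RelativeAuslander

namespace RelativeAuslander

open CategoryTheory Limits Opposite ZeroObject Pretriangulated

universe v u

/-! ### The comparison map from F(Z) to Hom(Z, e(F)) -/

section
variable {A : Type u} [Category.{v} A] [Abelian A] {X : ObjectProperty A}

/-! The functor e is exact and has a fully faithful right adjoint, the restricted Yoneda functor M ↦
Hom(-, M)|_X. By Yoneda, a morphism from F to Hom(-, M)|_X is a map X₀ ⟶ M that vanishes on X₁, that
is, a map e(F) ⟶ M. Contravariant finiteness makes Hom(-, M)|_X finitely presented; projectives in X
that cover every module make the functor fully faithful (`functorEAdjunction` and the two instances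
after it).

The right adjoint need not be exact, but passing to K^b only requires additivity. So the adjunction
extends termwise to K^b, its counit is still invertible, and K^b(e) is a localization at the
morphisms it inverts. Followed by the quotient K^b(mod Λ) ⟶ D^b(mod Λ), it becomes a localization at
the morphisms whose cone goes to an acyclic complex under e (`isLocalization_mapKb_comp_DbQ`). Since
Λ is a projective generator lying in X, F(Λ) ≅ Hom(Λ, e(F)), so these cones are exactly the
complexes acyclic at Λ (`kbRegularAcyclic_eq`). Thus `eTilde` compares two localizations at the same
class, and is an equivalence.

The same localization factors through D^b(mod X), itself a localization of K^b(mod X). Hence D^b_e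
is a localization at the image of that class, which is the class of morphisms with cone in its
kernel (`dbZero_trW`), and the second equivalence follows. -/

theorem functorE_ev_eq {F : FPMod X} {Z : X.FullSubcategory} {g g' : Z ⟶ F.pres.X₀}
    (h : F.pres.ev Z g = F.pres.ev Z g') : g.hom ≫ functorEπ F = g'.hom ≫ functorEπ F := by
  rw [← sub_eq_zero, ← map_sub, ProjPresentation.ev_eq_zero_iff] at h
  obtain ⟨k, hk⟩ := h
  have hk' : k.hom ≫ F.pres.d.hom = g.hom - g'.hom := congrArg (fun t => t.hom) hk
  obtain ⟨w, _⟩ := functorE_exact_pres F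
  rw [← sub_eq_zero, ← Preadditive.sub_comp, ← hk', Category.assoc, w, comp_zero]

/-- The map `F(Z) → A(Z, e(F))`, the component at `F` and `Z` of the unit of the adjunction between
`e` and the restricted Yoneda functor. -/
noncomputable def toHomE (F : FPMod X) (Z : X.FullSubcategory) :
    F.obj.obj (op Z) →+ (Z.obj ⟶ (functorE X).obj F) :=
  AddMonoidHom.mk' (fun x => (F.pres.ev_surj Z x).choose.hom ≫ functorEπ F) fun x y => by
    rw [← Preadditive.add_comp]
    refine functorE_ev_eq (g' := (F.pres.ev_surj Z x).choose + (F.pres.ev_surj Z y).choose) ?_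
    rw [map_add, (F.pres.ev_surj Z x).choose_spec, (F.pres.ev_surj Z y).choose_spec]
    exact (F.pres.ev_surj Z (x + y)).choose_spec

/-- Independence of the chosen lift in `toHomE`: two lifts of an element to X₀ differ by a map
through X₁, which dies in e(F). -/
theorem toHomE_ev (F : FPMod X) {Z : X.FullSubcategory} (g : Z ⟶ F.pres.X₀) :
    toHomE F Z (F.pres.ev Z g) = g.hom ≫ functorEπ F :=
  functorE_ev_eq (F.pres.ev_surj Z _).choose_spec

theorem toHomE_map (F : FPMod X) {Z Z' : X.FullSubcategory} (h : Z' ⟶ Z) (x : F.obj.obj (op Z)) :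
    toHomE F Z' (F.obj.map h.op x) = h.hom ≫ toHomE F Z x := by
  obtain ⟨g, rfl⟩ := F.pres.ev_surj Z x
  rw [← F.pres.ev_comp, toHomE_ev, toHomE_ev]
  exact Category.assoc _ _ _

theorem toHomE_naturality {F G : FPMod X} (f : F ⟶ G) {Z : X.FullSubcategory}
    (x : F.obj.obj (op Z)) :
    toHomE G Z (f.hom.app (op Z) x) = toHomE F Z x ≫ (functorE X).map f := by
  obtain ⟨f₀, hf⟩ := F.pres.exists_lift G.pres f.hom
  obtain ⟨g, rfl⟩ := F.pres.ev_surj Z x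
  rw [← hf, toHomE_ev, toHomE_ev, Category.assoc, functorEπ_map f hf]
  exact Category.assoc _ _ _

/-- Exactness of `F₁(Z) → F₂(Z) → F₃(Z)` for `Z` projective in the ambient category, from the
exactness of the sequence of the images under `e`. -/
theorem exact_app_of_functorE_exact (S : ShortComplex (FPMod X))
    (hS : (S.map (functorE X)).Exact) (Z : X.FullSubcategory) [Projective Z.obj] :
    Function.Exact (S.f.hom.app (op Z)) (S.g.hom.app (op Z)) := by
  -- For Z projective, F(Z) ⟶ Hom(Z, e(F)) is injective: a map Z ⟶ X₀ that dies in e(F) lifts along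
  -- X₁ ⟶ X₀.
  have key (F : FPMod X) (x : F.obj.obj (op Z)) (hx : toHomE F Z x = 0) : x = 0 := by
    obtain ⟨g, rfl⟩ := F.pres.ev_surj Z x
    rw [toHomE_ev] at hx
    obtain ⟨_, hex⟩ := functorE_exact_pres F
    rw [ProjPresentation.ev_eq_zero_iff]
    exact ⟨ObjectProperty.homMk (hex.liftFromProjective g.hom hx),
      ObjectProperty.hom_ext _ (hex.liftFromProjective_comp g.hom hx)⟩
  intro y
  constructor
  · intro hy
    have h0 : toHomE S.X₂ Z y ≫ (S.map (functorE X)).g = 0 := by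
      refine (toHomE_naturality S.g y).symm.trans ?_
      rw [hy, map_zero]
      rfl
    obtain ⟨l, hl⟩ : ∃ l : Z.obj ⟶ (functorE X).obj S.X₁,
        l ≫ (functorE X).map S.f = toHomE S.X₂ Z y :=
      ⟨hS.liftFromProjective (toHomE S.X₂ Z y) h0, hS.liftFromProjective_comp _ h0⟩
    -- Projectivity of Z lifts `l` to X₀, which gives an element of F₁(Z) with image `l`; its image
    -- in F₂(Z) equals `y` by the injectivity in `key`.
    refine ⟨S.X₁.pres.ev Z (ObjectProperty.homMk (Projective.factorThru l (functorEπ S.X₁))),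
      sub_eq_zero.1 (key _ _ ?_)⟩
    rw [map_sub, toHomE_naturality, toHomE_ev, sub_eq_zero, ← hl]
    exact congrArg (· ≫ (functorE X).map S.f) (Projective.factorThru_comp _ _)
  · rintro ⟨x, rfl⟩
    exact ConcreteCategory.congr_hom
      (NatTrans.congr_app (congrArg (fun t => t.hom) S.zero) (op Z)) x

/-! ### The restricted Yoneda functor as a fully faithful right adjoint of e -/

variable [ContravariantlyFinite X]

variable (X) in
/-- The functor `A ⥤ mod X` that sends `M` to the restriction of `A(-, M)` to `X`. -/
noncomputable def restrictedYoneda : A ⥤ FPMod X :=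
  (finPres X.FullSubcategory).lift (preadditiveYoneda ⋙ (Functor.whiskeringLeft _ _ _).obj X.ι.op)
    -- The datum 0 ⟶ M presents Hom(-, M) by objects that need not lie in X; `finPres_of_data`
    -- replaces them by X-approximations.
    fun M => finPres_of_data _ (0 : 0 ⟶ M) (fun Z => AddMonoidHom.id _) (fun _ _ => rfl)
      (fun Z x => ⟨x, rfl⟩) fun Z g => by
        constructor
        · intro h
          exact ⟨0, zero_comp.trans h.symm⟩
        · rintro ⟨h, rfl⟩
          exact comp_zero

instance : (restrictedYoneda X).Additive where
  map_add {M N f g} := by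
    apply ObjectProperty.hom_ext
    ext Z x
    exact Preadditive.comp_add _ _ _ _ _ _

/-- The component `F(Z) → A(Z, M)` of a morphism from `F` to the restriction of `A(-, M)`. -/
noncomputable def homApp {F : FPMod X} {M : A} (φ : F ⟶ (restrictedYoneda X).obj M)
    (Z : X.FullSubcategory) : F.obj.obj (op Z) →+ (Z.obj ⟶ M) :=
  (φ.hom.app (op Z)).hom

theorem homApp_map {F : FPMod X} {M : A} (φ : F ⟶ (restrictedYoneda X).obj M)
    {Z Z' : X.FullSubcategory} (h : Z' ⟶ Z) (x : F.obj.obj (op Z)) :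
    homApp φ Z' (F.obj.map h.op x) = h.hom ≫ homApp φ Z x :=
  nat_app φ.hom h x

theorem homApp_ext {F : FPMod X} {M : A} {φ ψ : F ⟶ (restrictedYoneda X).obj M}
    (h : ∀ Z x, homApp φ Z x = homApp ψ Z x) : φ = ψ :=
  ObjectProperty.hom_ext _ (NatTrans.ext (funext fun Z => AddCommGrpCat.ext fun x => h Z.unop x))

theorem homApp_comp {F G : FPMod X} {M : A} (f : F ⟶ G) (φ : G ⟶ (restrictedYoneda X).obj M)
    (Z : X.FullSubcategory) (x : F.obj.obj (op Z)) :
    homApp (f ≫ φ) Z x = homApp φ Z (f.hom.app (op Z) x) :=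
  rfl

/-- The morphism `F ⟶ A(-, M)` corresponding to a morphism `e(F) ⟶ M`. -/
noncomputable def toRestrictedYoneda {F : FPMod X} {M : A} (f : (functorE X).obj F ⟶ M) :
    F ⟶ (restrictedYoneda X).obj M :=
  ObjectProperty.homMk
    { app Z := AddCommGrpCat.ofHom ((Preadditive.rightComp _ f).comp (toHomE F Z.unop))
      naturality Z Z' h := by
        ext x
        exact (congrArg (· ≫ f) (toHomE_map F h.unop x)).trans (Category.assoc _ _ _) }

theorem homApp_toRestrictedYoneda {F : FPMod X} {M : A} (f : (functorE X).obj F ⟶ M)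
    (Z : X.FullSubcategory) (x : F.obj.obj (op Z)) :
    homApp (toRestrictedYoneda f) Z x = toHomE F Z x ≫ f :=
  rfl

/-- The morphism `e(F) ⟶ M` corresponding to a morphism `F ⟶ A(-, M)`. -/
noncomputable def ofRestrictedYoneda {F : FPMod X} {M : A} (φ : F ⟶ (restrictedYoneda X).obj M) :
    (functorE X).obj F ⟶ M :=
  -- Yoneda: φ evaluated at the universal element of F(X₀) is a map X₀ ⟶ M, and the universal
  -- element restricts to zero on X₁.
  cokernel.desc _ (homApp φ _ (F.pres.ev _ (𝟙 _))) (by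
    rw [← homApp_map, ← F.pres.ev_comp, (F.pres.ev_eq_zero_iff _).2 ⟨𝟙 _, by simp⟩, map_zero])

theorem functorEπ_ofRestrictedYoneda {F : FPMod X} {M : A}
    (φ : F ⟶ (restrictedYoneda X).obj M) :
    functorEπ F ≫ ofRestrictedYoneda φ = homApp φ _ (F.pres.ev _ (𝟙 _)) :=
  cokernel.π_desc _ _ _

/-- The functor `e` is left adjoint to the restricted Yoneda functor. -/
noncomputable def functorEAdjunction : functorE X ⊣ restrictedYoneda X :=
  Adjunction.mkOfHomEquiv
    { homEquiv F M :=
        { toFun := toRestrictedYoneda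
          invFun := ofRestrictedYoneda
          left_inv f := by
            rw [← cancel_epi (functorEπ F), functorEπ_ofRestrictedYoneda,
              homApp_toRestrictedYoneda, toHomE_ev]
            exact congrArg (· ≫ f) (Category.id_comp _)
          right_inv φ := homApp_ext fun Z x => by
            obtain ⟨g, rfl⟩ := F.pres.ev_surj Z x
            rw [homApp_toRestrictedYoneda, toHomE_ev, Category.assoc,
              functorEπ_ofRestrictedYoneda, ← homApp_map, ← F.pres.ev_comp, Category.comp_id] }
      homEquiv_naturality_left_symm {F F' M} f φ := by
        obtain ⟨f₀, hf⟩ := F.pres.exists_lift F'.pres f.hom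
        change ofRestrictedYoneda (f ≫ φ) = (functorE X).map f ≫ ofRestrictedYoneda φ
        rw [← cancel_epi (functorEπ F), ← Category.assoc, functorEπ_map f hf, Category.assoc,
          functorEπ_ofRestrictedYoneda, functorEπ_ofRestrictedYoneda, homApp_comp, ← hf,
          ← homApp_map, ← F'.pres.ev_comp, Category.comp_id, Category.id_comp]
      homEquiv_naturality_right {F M M'} f g :=
        homApp_ext fun Z x => (Category.assoc _ _ _).symm }

variable [HasEnoughProjectivesIn X]

/-- An epimorphism π : P ⟶ M with P in X is an element of Hom(P, M), so the transformations induced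
by f and g already determine π ≫ f and π ≫ g. -/
instance : (restrictedYoneda X).Faithful where
  map_injective {M N f g} h := by
    obtain ⟨P, hP, _, π, _⟩ := HasEnoughProjectivesIn.exists_epi (X := X) M
    rw [← cancel_epi π]
    exact ConcreteCategory.congr_hom
      (NatTrans.congr_app (congrArg (fun t => t.hom) h) (op ⟨P, hP⟩)) π

/-- A transformation φ is recovered from its value at one cover p : P ⟶ M with P in X: naturality
makes φ(p) vanish on the kernel of p, so it descends to f : M ⟶ N. That φ is composition with f is
then checked after pulling back along p. -/
instance : (restrictedYoneda X).Full where
  map_surjective {M N} φ := by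
    have hcomp {Z Z' : X.FullSubcategory} (h : Z'.obj ⟶ Z.obj) (g : Z.obj ⟶ M) :
        homApp φ Z' (h ≫ g) = h ≫ homApp φ Z g := homApp_map φ (ObjectProperty.homMk h) g
    obtain ⟨P, hP, _, p, _⟩ := HasEnoughProjectivesIn.exists_epi (X := X) M
    obtain ⟨Q, hQ, _, q, _⟩ := HasEnoughProjectivesIn.exists_epi (X := X) (kernel p)
    -- The kernel of p may lie outside X, where φ is undefined, so it is covered by Q in X.
    have hs : kernel.ι p ≫ homApp φ ⟨P, hP⟩ p = 0 := by
      rw [← cancel_epi q, comp_zero, ← Category.assoc]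
      refine (hcomp (Z := ⟨P, hP⟩) (Z' := ⟨Q, hQ⟩) (q ≫ kernel.ι p) p).symm.trans ?_
      rw [Category.assoc, kernel.condition, comp_zero]
      exact map_zero (homApp φ ⟨Q, hQ⟩)
    let f : M ⟶ N := (Abelian.epiIsCokernelOfKernel _ (kernelIsKernel p)).desc
      (CokernelCofork.ofπ _ hs)
    have hf : p ≫ f = homApp φ ⟨P, hP⟩ p :=
      (Abelian.epiIsCokernelOfKernel _ (kernelIsKernel p)).fac (CokernelCofork.ofπ _ hs) .one
    refine ⟨f, homApp_ext fun Z (g : Z.obj ⟶ M) => ?_⟩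
    -- R in X covers the pullback of g and p. The composite R ⟶ Z is epi because p is, and along it
    -- g factors through p, where φ is known.
    obtain ⟨R, hR, _, r, _⟩ := HasEnoughProjectivesIn.exists_epi (X := X) (pullback g p)
    have h : (r ≫ pullback.fst g p) ≫ g = (r ≫ pullback.snd g p) ≫ p := by
      simp [pullback.condition]
    rw [← cancel_epi (r ≫ pullback.fst g p)]
    refine Eq.trans ?_ (hcomp (Z := Z) (Z' := ⟨R, hR⟩) (r ≫ pullback.fst g p) g)
    refine Eq.trans ?_ (congrArg (homApp φ ⟨R, hR⟩) h).symm
    refine Eq.trans ?_ (hcomp (Z := ⟨P, hP⟩) (Z' := ⟨R, hR⟩) (r ≫ pullback.snd g p) p).symm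
    rw [← hf]
    change (r ≫ pullback.fst g p) ≫ g ≫ f = _
    rw [← Category.assoc, h, Category.assoc]

end

/-! ### Comparing localizations, and kernels of triangle functors -/

section
variable {C D E : Type*} [Category* C] [Category* D] [Category* E]

/-- Both G and the canonical equivalence between two localizations at W lift `L'` along L, and such
a lift is unique up to isomorphism. -/
theorem isEquivalence_of_comp_iso (L : C ⥤ D) (L' : C ⥤ E) (W : MorphismProperty C)
    [L.IsLocalization W] [L'.IsLocalization W] (G : D ⥤ E) (e : L ⋙ G ≅ L') :
    G.IsEquivalence := by
  have : Localization.Lifting L W L' G := ⟨e⟩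
  have : Localization.Lifting L W L' (Localization.uniq L L' W).functor :=
    ⟨Localization.compUniqFunctor L L' W⟩
  exact Functor.isEquivalence_of_iso (Localization.liftNatIso L W L' L'
    (Localization.uniq L L' W).functor G (Iso.refl _))

end

section
variable {T T' : Type*} [Category* T] [Category* T']
  [HasZeroObject T] [HasShift T ℤ] [Preadditive T] [∀ n : ℤ, (shiftFunctor T n).Additive]
  [Pretriangulated T] [IsTriangulated T]
  [HasZeroObject T'] [HasShift T' ℤ] [Preadditive T'] [∀ n : ℤ, (shiftFunctor T' n).Additive]
  [Pretriangulated T'] (F : T ⥤ T') [F.CommShift ℤ] [F.IsTriangulated]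

/-- A triangle functor F sends the cone of f to a cone of F(f), which is zero exactly when F(f) is
invertible. -/
theorem kernel_trW_iff {X Y : T} (f : X ⟶ Y) : F.kernel.trW f ↔ IsIso (F.map f) := by
  refine ⟨trW_isInvertedBy _ F le_rfl f, fun h => ?_⟩
  obtain ⟨Z, g, k, hT⟩ := distinguished_cocone_triangle f
  exact (F.kernel.trW_iff f).2 ⟨Z, g, k, hT,
    (Triangle.isZero₃_iff_isIso₁ _ (F.map_distinguished _ hT)).2 h⟩

end

/-! ### Passing an adjunction to K^b and D^b -/

section
variable {A B : Type*} [Category* A] [Category* B]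

section
variable [Preadditive A] [Preadditive B]

/-- An adjunction between additive functors induces one between the functors on the bounded
homotopy categories. -/
noncomputable def mapKbAdjunction {F : A ⥤ B} {G : B ⥤ A} [F.Additive] [G.Additive] (adj : F ⊣ G) :
    mapKb F ⊣ mapKb G :=
  { unit :=
      { app K := ObjectProperty.homMk ((HomotopyCategory.quotient _ _).map
          ((NatTrans.mapHomologicalComplex adj.unit (.up ℤ)).app K.obj.as))
        naturality K L f := by
          -- Morphisms are homotopy classes; on a chain map representing the class, naturality holds
          -- before passing to homotopy.
          obtain ⟨φ, hφ⟩ := (HomotopyCategory.quotient A (.up ℤ)).map_surjective f.hom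
          obtain rfl : ObjectProperty.homMk ((HomotopyCategory.quotient A (.up ℤ)).map φ) = f :=
            ObjectProperty.hom_ext _ hφ
          exact ObjectProperty.hom_ext _ (congrArg (HomotopyCategory.quotient A (.up ℤ)).map
            ((NatTrans.mapHomologicalComplex adj.unit (.up ℤ)).naturality φ)) }
    counit :=
      { app K := ObjectProperty.homMk ((HomotopyCategory.quotient _ _).map
          ((NatTrans.mapHomologicalComplex adj.counit (.up ℤ)).app K.obj.as))
        naturality K L f := by
          obtain ⟨φ, hφ⟩ := (HomotopyCategory.quotient B (.up ℤ)).map_surjective f.hom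
          obtain rfl : ObjectProperty.homMk ((HomotopyCategory.quotient B (.up ℤ)).map φ) = f :=
            ObjectProperty.hom_ext _ hφ
          exact ObjectProperty.hom_ext _ (congrArg (HomotopyCategory.quotient B (.up ℤ)).map
            ((NatTrans.mapHomologicalComplex adj.counit (.up ℤ)).naturality φ)) }
    left_triangle_components K := by
      refine ObjectProperty.hom_ext _ (Eq.trans ?_ ((HomotopyCategory.quotient B (.up ℤ)).map_id _))
      refine congrArg (HomotopyCategory.quotient B (.up ℤ)).map (HomologicalComplex.hom_ext
        (((F.mapHomologicalComplex (.up ℤ)).map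
          ((NatTrans.mapHomologicalComplex adj.unit (.up ℤ)).app K.obj.as)) ≫
          (NatTrans.mapHomologicalComplex adj.counit (.up ℤ)).app
            ((F.mapHomologicalComplex (.up ℤ)).obj K.obj.as)) (𝟙 _) fun n => ?_)
      exact adj.left_triangle_components _
    right_triangle_components K := by
      refine ObjectProperty.hom_ext _ (Eq.trans ?_ ((HomotopyCategory.quotient A (.up ℤ)).map_id _))
      refine congrArg (HomotopyCategory.quotient A (.up ℤ)).map (HomologicalComplex.hom_ext
        ((NatTrans.mapHomologicalComplex adj.unit (.up ℤ)).app
            ((G.mapHomologicalComplex (.up ℤ)).obj K.obj.as) ≫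
          (G.mapHomologicalComplex (.up ℤ)).map
            ((NatTrans.mapHomologicalComplex adj.counit (.up ℤ)).app K.obj.as)) (𝟙 _) fun n => ?_)
      exact adj.right_triangle_components _ }

/-- In each degree the counit is that of `adj`, an isomorphism since G is fully faithful; so it is
already invertible as a chain map. -/
instance {F : A ⥤ B} {G : B ⥤ A} [F.Additive] [G.Additive] [G.Full] [G.Faithful] (adj : F ⊣ G) :
    IsIso (mapKbAdjunction adj).counit := by
  refine @NatIso.isIso_of_isIso_app _ _ _ _ _ _ _ fun K => ?_
  have : IsIso ((NatTrans.mapHomologicalComplex adj.counit (.up ℤ)).app K.obj.as) :=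
    @HomologicalComplex.Hom.isIso_of_components _ _ _ _ _ _ _ _ fun n =>
      inferInstanceAs (IsIso (adj.counit.app (K.obj.as.X n)))
  have : IsIso ((boundedComplexes B).ι.map ((mapKbAdjunction adj).counit.app K)) :=
    inferInstanceAs (IsIso ((HomotopyCategory.quotient B (.up ℤ)).map
      ((NatTrans.mapHomologicalComplex adj.counit (.up ℤ)).app K.obj.as)))
  exact isIso_of_fully_faithful (boundedComplexes B).ι _

end

variable [Abelian A] [Abelian B]

/-- Saturation of the quasi-isomorphisms: each homology functor factors through D^b, so a morphism
invertible there induces isomorphisms on homology. -/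
theorem kbAcyclic_trW_of_isIso {K L : Kb A} (f : K ⟶ L) (hf : IsIso ((DbQ A).map f)) :
    (KbAcyclic A).trW f := by
  rw [ObjectProperty.inverseImage_trW_iff, ← HomotopyCategory.quasiIso_eq_trW_subcategoryAcyclic]
  have h (n : ℤ) : (KbAcyclic A).trW.IsInvertedBy
      ((boundedComplexes A).ι ⋙ HomotopyCategory.homologyFunctor A (.up ℤ) n) := by
    intro K L f hf
    rw [ObjectProperty.inverseImage_trW_iff,
      ← HomotopyCategory.quasiIso_eq_trW_subcategoryAcyclic] at hf
    exact hf n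
  intro n
  exact ((MorphismProperty.isomorphisms _).arrow_mk_iso_iff
    (((Functor.mapArrowFunctor _ _).mapIso (Localization.fac _ (h n) (DbQ A))).app (.mk f))).1
      (inferInstanceAs (IsIso ((Localization.lift _ (h n) (DbQ A)).map ((DbQ A).map f))))

/-- If an exact functor `F` has a fully faithful right adjoint, then the bounded derived category of
the target is the localization of `K^b(A)` at the morphisms whose cone is sent by `F` to an acyclic
complex. -/
theorem isLocalization_mapKb_comp_DbQ {F : A ⥤ B} {G : B ⥤ A} [F.Additive] [G.Additive]
    [G.Full] [G.Faithful] (adj : F ⊣ G) :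
    (mapKb F ⋙ DbQ B).IsLocalization ((KbAcyclic B).inverseImage (mapKb F)).trW := by
  have := (mapKbAdjunction adj).fullyFaithfulROfIsIsoCounit.full
  have := (mapKbAdjunction adj).fullyFaithfulROfIsIsoCounit.faithful
  -- A left adjoint with fully faithful right adjoint is a localization at the morphisms it inverts.
  -- To compose it with `DbQ B`, each quasi-isomorphism in K^b(B) must come from K^b(A).
  have := (mapKbAdjunction adj).isLocalization
  refine Functor.IsLocalization.comp _ _ ((MorphismProperty.isomorphisms _).inverseImage (mapKb F))
    (KbAcyclic B).trW _ (ObjectProperty.inverseImage_trW_isInverted _ _ _) ?_ ?_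
  · intro K L f (hf : IsIso _)
    rw [ObjectProperty.inverseImage_trW_iff]
    exact ObjectProperty.trW_of_isIso _ _
  · intro K L f hf
    -- The invertible counit exhibits f as the image of G(f), up to isomorphism of arrows.
    let e : Arrow.mk ((mapKb F).map ((mapKb G).map f)) ≅ Arrow.mk f :=
      ((Functor.mapArrowFunctor _ _).mapIso (asIso (mapKbAdjunction adj).counit)).app (.mk f)
    refine ⟨_, _, (mapKb G).map f, ?_, ⟨e⟩⟩
    rw [ObjectProperty.inverseImage_trW_iff]
    exact ((KbAcyclic B).trW.arrow_mk_iso_iff e).2 hf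

end

/-! ### The two equivalences for mod Λ -/

section
variable (Λ : Type u) [Ring Λ] [IsArtinAlgebra Λ]
variable (X : ObjectProperty (ModCat Λ)) [ContravariantlyFinite X] [ContainsPrj X]

/-- Projectivity of Λ passes exactness of e(F) to F(Λ); the converse also uses that Λ is a
generator, so that exactness in mod Λ is tested by maps out of Λ. -/
theorem kbRegularAcyclic_eq :
    KbRegularAcyclic X = (KbAcyclic (ModCat Λ)).inverseImage (mapKb (functorE X)) := by
  ext K
  have : Projective (regularObject X).obj := (prj_regularModule Λ).projective
  refine (kbRegularAcyclic_iff X K).trans (Iff.trans (forall_congr' fun n => ?_)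
    (kbAcyclic_iff _).symm)
  constructor
  · intro h
    exact exact_of_regularModule _ (functorE_lift (K.obj.as.sc n) (regularObject X)
      ((ShortComplex.ab_exact_iff_function_exact _).1 h))
  · intro h
    exact (ShortComplex.ab_exact_iff_function_exact _).2
      (exact_app_of_functorE_exact (K.obj.as.sc n) h (regularObject X))

instance : (mapKb (functorE X) ⋙ DbQ (ModCat Λ)).IsLocalization (KbRegularAcyclic X).trW := by
  rw [kbRegularAcyclic_eq]
  exact isLocalization_mapKb_comp_DbQ functorEAdjunction

/-- The functor `eTilde X` extends the termwise application of `e`. -/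
noncomputable def verdierQCompETilde :
    verdierQ (KbRegularAcyclic X) ⋙ eTilde X ≅ mapKb (functorE X) ⋙ DbQ (ModCat Λ) :=
  (Functor.associator _ _ _).symm ≪≫
    Functor.isoWhiskerRight (verdierLiftFac (KbRegularAcyclic X) _ (kbRegularAcyclic_le X)) _ ≪≫
    Functor.associator _ _ _ ≪≫
    Functor.isoWhiskerLeft (DbQ (FPMod X)) (verdierLiftFac (DbZero X) (DbE X) le_rfl) ≪≫
    mapDbFac (functorE X)

theorem eTilde_isEquivalence : (eTilde X).IsEquivalence :=
  isEquivalence_of_comp_iso (verdierQ (KbRegularAcyclic X)) _ (KbRegularAcyclic X).trW _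
    (verdierQCompETilde Λ X)

/-- For f in K^b(mod X), its image has cone in the kernel of D^b_e iff e(f) is invertible in D^b(mod
Λ), iff e(f) is a quasi-isomorphism by saturation, iff the cone of f is acyclic at Λ. -/
theorem dbZero_trW :
    (DbZero X).trW = (KbRegularAcyclic X).trW.map (DbQ (FPMod X)) := by
  have key {K L : Kb (FPMod X)} (f : K ⟶ L) :
      (DbZero X).trW ((DbQ (FPMod X)).map f) ↔ (KbRegularAcyclic X).trW f := by
    rw [DbZero, kernel_trW_iff, kbRegularAcyclic_eq, ObjectProperty.inverseImage_trW_iff]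
    let e := ((Functor.mapArrowFunctor _ _).mapIso (mapDbFac (functorE X))).app (.mk f)
    refine ((MorphismProperty.isomorphisms _).arrow_mk_iso_iff e).trans
      ⟨fun h => kbAcyclic_trW_of_isIso _ h, fun h => Localization.inverts (DbQ (ModCat Λ)) _ _ h⟩
  apply le_antisymm
  · intro Y Z f hf
    -- By calculus of fractions, every morphism of D^b(mod X) is isomorphic, as an arrow, to the
    -- image of one in K^b(mod X), which reduces the claim to `key`.
    have := Localization.essSurj_mapArrow (DbQ (FPMod X)) (KbAcyclic (FPMod X)).trW
    let f' := (DbQ (FPMod X)).mapArrow.objPreimage (.mk f)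
    let e : Arrow.mk ((DbQ (FPMod X)).map f'.hom) ≅ Arrow.mk f :=
      (DbQ (FPMod X)).mapArrow.objObjPreimageIso (.mk f)
    exact ⟨_, _, f'.hom, (key _).1 (((DbZero X).trW.arrow_mk_iso_iff e).2 hf), ⟨e⟩⟩
  · rintro Y Z f ⟨K, L, f', hf', ⟨e⟩⟩
    exact ((DbZero X).trW.arrow_mk_iso_iff e).1 ((key f').2 hf')

/-- Cancellation: K^b(mod X) ⟶ D^b(mod X) and its composite with D^b_e are localizations, the latter
at a larger class because e is exact; so D^b_e is a localization at the image of that class. -/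
instance : (DbE X).IsLocalization (DbZero X).trW := by
  have : (DbQ (FPMod X) ⋙ DbE X).IsLocalization (KbRegularAcyclic X).trW :=
    Functor.IsLocalization.of_iso _ (mapDbFac (functorE X)).symm
  refine Functor.IsLocalization.of_comp (DbQ (FPMod X)) (DbE X) (KbAcyclic (FPMod X)).trW _
    (KbRegularAcyclic X).trW (ObjectProperty.trW_monotone fun K hK => ?_) (dbZero_trW Λ X)
  rw [kbRegularAcyclic_eq]
  exact (kbAcyclic_iff _).2 fun n => ((kbAcyclic_iff _).1 hK n).map (functorE X)

theorem DbETilde_isEquivalence : (DbETilde X).IsEquivalence :=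
  isEquivalence_of_comp_iso (verdierQ (DbZero X)) (DbE X) (DbZero X).trW _
    (verdierLiftFac (DbZero X) (DbE X) le_rfl)

instance : (DbETilde X).IsTriangulated :=
  verdierLift_isTriangulated (DbZero X) (DbE X) le_rfl

instance : (psi X).IsTriangulated :=
  inferInstanceAs (verdierLift (KbRegularAcyclic X) (DbQ (FPMod X) ⋙ verdierQ (DbZero X))
    (kbRegularAcyclic_le X)).IsTriangulated

instance : (eTilde X).IsTriangulated :=
  inferInstanceAs (psi X ⋙ DbETilde X).IsTriangulated

end
end RelativeAuslander

theorem mainTheorem4 (Λ : Type*) [Ring Λ] [RelativeAuslander.IsArtinAlgebra Λ]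
    (X : CategoryTheory.ObjectProperty (RelativeAuslander.ModCat Λ))
    [RelativeAuslander.ContravariantlyFinite X] [RelativeAuslander.ContainsPrj X] :
    ((RelativeAuslander.eTilde X).IsTriangulated ∧
      (RelativeAuslander.eTilde X).IsEquivalence) ∧
    ((RelativeAuslander.DbETilde X).IsTriangulated ∧
      (RelativeAuslander.DbETilde X).IsEquivalence) :=
  ⟨⟨inferInstance, RelativeAuslander.eTilde_isEquivalence Λ X⟩,
    ⟨inferInstance, RelativeAuslander.DbETilde_isEquivalence Λ X⟩⟩
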